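/- **Setting.** A network is a finite connected undirected graph $G=(V,E)$ with a root $t$ and edge costs $c_e\ge 0$. For a set $S\subseteq V\setminus\{t\}$ of activated vertices, each $s\in S$ is a player who chooses a path $P_s$ from $s$ to $t$. An *ordered* universal cost-sharing protocol fixes, knowing $G$ but not $S$, a total order $\pi$ of $V$; the full cost $c_e$ of each used edge is then charged to the $\pi$-first player using $e$. (It is the generalized weighted Shapley protocol whose ordered partition consists of singletons.) A pure Nash equilibrium is an outcome $P=(P_s)_{s\in S}$ in which no player can lower the total of her shares by changing her path alone. The cost $c(P)$ of an outcome is the total cost of the edges in $\bigcup_s P_s$, $\mathrm{opt}(S)$ is the minimum cost of an outcome, and the Price of Anarchy for $S$ is the maximum of $c(P)/\mathrm{opt}(S)$ over all pure Nash equilibria $P$. **Theorem.** There is an absolute constant $c>0$ such that the following hold. 1. For every integer $k\ge 2$ there is a network such that for every ordered universal cost-sharing protocol on it there is a set $S\subseteq V\setminus\{t\}$ with exactly $k$ activated vertices, $\mathrm{opt}(S)>0$, for which the Price of Anarchy is at least $c\log k$. 2. For $k=2^r+1$, $r\ge 1$, the network can be chosen as follows, for a suitable $n=n(r)$: its vertices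 are those of the hypercube $Q_n$ together with $t$; every two vertices are joined by an edge, whose cost is $2^r$ if one endpoint is $t$, and the hypercube (Hamming) distance of the endpoints otherwise. For every ordered protocol, with order $\pi$, one can take as $S$ the vertex set of a path $(v_0,\dots,v_{2^r})$ of $Q_n$ that is isometric, i.e. $d_{Q_n}(v_a,v_b)=|a-b|$ for all $a,b$, and zig-zag with respect to $\pi$: if $1\le j\le r$ and $a$ is divisible by $2^{r-j}$ but not by $2^{r-j+1}$, then $v_{a-2^{r-j}}$ and $v_{a+2^{r-j}}$ both precede $v_a$ in $\pi$. -/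

import Mathlib

open scoped ENNReal NNReal

/-- A rooted undirected network: a connected graph with a root and nonnegative edge costs.
The values of `cost` outside `graph.edgeSet` are never used. -/
structure Network (V : Type*) where
  graph : SimpleGraph V
  connected : graph.Connected
  root : V
  cost : Sym2 V → ℝ
  cost_nonneg : ∀ e ∈ graph.edgeSet, 0 ≤ cost e

/-- A cost-sharing protocol on the potential players `V`: `ξ e R i` is the share of the edge `e`
paid by the player `i` when `R` is the set of players using `e`. -/
abbrev CostSharingProtocol (V : Type*) := Sym2 V → Finset V → V → ℝ

/-- The data of a generalized weighted Shapley protocol on the potential players `V`: positive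
weights, and an ordered partition of `V` given by `rank` (its blocks are the nonempty fibres of
`rank`, a smaller rank coming earlier). -/
structure GWSP (V : Type*) where
  weight : V → ℝ
  weight_pos : ∀ v, 0 < weight v
  rank : V → ℕ

namespace GWSP

variable {V : Type*}

/-- The users in `R` that belong to the earliest block meeting `R`. -/
def firstBlock (Ξ : GWSP V) (R : Finset V) : Finset V :=
  R.filter fun i => ∀ j ∈ R, Ξ.rank i ≤ Ξ.rank j

/-- The generalized weighted Shapley protocol on the network `N`: the cost of an edge is split
among the users of the earliest block, proportionally to their weights. -/
noncomputable def toProtocol [DecidableEq V] (Ξ : GWSP V) (N : Network V) :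
    CostSharingProtocol V := fun e R i =>
  if i ∈ Ξ.firstBlock R then Ξ.weight i / (∑ j ∈ Ξ.firstBlock R, Ξ.weight j) * N.cost e else 0

/-- The protocol is ordered: every block is a single player. -/
def IsOrdered (Ξ : GWSP V) : Prop := Function.Injective Ξ.rank

end GWSP

namespace Network

variable {V : Type*} [DecidableEq V]

/-- A strategy profile for the set `S` of activated vertices: every activated vertex chooses a
(simple) path to the root. -/
abbrev Profile (N : Network V) (S : Finset V) := ∀ i : S, N.graph.Path (i : V) N.root

/-- The set of players whose path uses the edge `e`. -/
def users (N : Network V) {S : Finset V} (P : N.Profile S) (e : Sym2 V) : Finset V :=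
  (Finset.univ.filter fun i : S => e ∈ (P i).1.edges).map (Function.Embedding.subtype _)

/-- The cost share of player `i` in the profile `P`. -/
noncomputable def playerCost (N : Network V) (ξ : CostSharingProtocol V) {S : Finset V}
    (P : N.Profile S) (i : S) : ℝ :=
  ∑ e ∈ (P i).1.edges.toFinset, ξ e (N.users P e) i

/-- Pure Nash equilibria. -/
def IsNash (N : Network V) (ξ : CostSharingProtocol V) {S : Finset V} (P : N.Profile S) : Prop :=
  ∀ (i : S) (p : N.graph.Path (i : V) N.root),
    N.playerCost ξ P i ≤ N.playerCost ξ (Function.update P i p) i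

/-- The cost of an outcome: the total cost of the union of the chosen paths. -/
noncomputable def socialCost (N : Network V) {S : Finset V} (P : N.Profile S) : ℝ :=
  ∑ e ∈ Finset.univ.biUnion (fun i : S => (P i).1.edges.toFinset), N.cost e

/-- The cost of an optimal outcome. -/
noncomputable def opt (N : Network V) (S : Finset V) : ℝ :=
  ⨅ P : N.Profile S, N.socialCost P

/-- The Price of Anarchy of the protocol `ξ` when exactly the vertices of `S` are activated. -/
noncomputable def priceOfAnarchy (N : Network V) (ξ : CostSharingProtocol V) (S : Finset V) :
    ℝ≥0∞ :=
  ⨆ P : {P : N.Profile S // N.IsNash ξ P},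
    ENNReal.ofReal (N.socialCost P.1) / ENNReal.ofReal (N.opt S)

end Network

/-- The `n`-dimensional hypercube with a root `none` added. Any two vertices are joined by an
edge; its cost is `ρ` if one of them is the root, and their hypercube distance otherwise. -/
noncomputable def rootedHypercube (n : ℕ) (ρ : ℝ≥0) :
    Network (Option (Fin n → Bool)) where
  graph := ⊤
  connected := SimpleGraph.connected_top
  root := none
  cost := Sym2.lift ⟨fun
    | some x, some y => (hammingDist x y : ℝ)
    | _, _ => (ρ : ℝ), by
      rintro (_ | x) (_ | y) <;> simp [hammingDist_comm]⟩
  cost_nonneg := by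
    intro e _
    induction e with
    | _ x y => rcases x with _ | x <;> rcases y with _ | y <;> simp

/-- The sequence `p 0, …, p (2 ^ r)` is an isometric path of the `n`-dimensional hypercube. -/
def IsIsometricPath {n r : ℕ} (p : Fin (2 ^ r + 1) → Fin n → Bool) : Prop :=
  ∀ a b, hammingDist (p a) (p b) = Nat.dist a b

/-- The labels `l 0, …, l (2 ^ r)` along a path are zig-zag. For `1 ≤ j ≤ r`, the class `j`
consists of the positions divisible by `2 ^ (r - j)` and not by `2 ^ (r - j + 1)`; the parents of
such a position are the two positions at distance `2 ^ (r - j)` from it, and their labels have to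
be smaller. -/
def IsZigZag {r : ℕ} (l : Fin (2 ^ r + 1) → ℕ) : Prop :=
  ∀ j, 1 ≤ j → j ≤ r → ∀ a : Fin (2 ^ r + 1),
    (a : ℕ) % 2 ^ (r - j) = 0 → (a : ℕ) % 2 ^ (r - j + 1) ≠ 0 →
      ∀ b : Fin (2 ^ r + 1), Nat.dist a b = 2 ^ (r - j) → l b < l a

/-! Label the points of the cube by their place in the order. Ramsey's theorem yields coordinates on
which, for sets of `D` elements, whether deleting an element lowers the label depends only on its
position. Let transversals of the pairs `{2q, 2q+1}` represent a smaller cube, scaled by two: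
flipping a coordinate exchanges the elements of one pair. If deletion raises the label at many
positions, the intersections of neighbouring transversals are midpoints with larger labels;
otherwise many consecutive positions lower it, and the unions are (`exists_scaled_cube`). Inserting
such midpoints into a zig-zag path of the smaller cube doubles its length, which gives the path by
induction (`exists_zigzag_walk`).

On the path, the parents of `a` are at distance `g = gcd a (2 ^ r)`. Route every player through a
parent. The parent comes earlier and uses the rest of the route, so `a` pays only `g`. Positions
nearer to `a` than `g` come later (`label_lt_of_dist_lt`), so any deviation costs at least `g`
before it meets an edge paid by someone else or the root: the routing is an equilibrium
(`Network.IsRouting.isNash`). Its cost is the sum of the gcds, `2 ^ r * (r + 4) / 2`, while walking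
along the path costs `2 * 2 ^ r`. Other numbers of players are reached by adding players at zero
cost from the root. -/

/-! ### Ramsey theory and labellings of finite sets -/

open Finset in
/-- A set of natural numbers in which the colour of a `(k + 1)`-subset depends on its minimum
only. -/
theorem exists_min_homogeneous {κ : Type*} [Nonempty κ] {k : ℕ}
    (hk : ∀ m, ∃ n, ∀ A : Finset ℕ, n ≤ #A → ∀ c : Finset ℕ → κ,
      ∃ M ⊆ A, #M = m ∧ ∃ a, ∀ s ⊆ M, #s = k → c s = a) (m : ℕ) :
    ∃ n, ∀ A : Finset ℕ, n ≤ #A → ∀ c : Finset ℕ → κ,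
      ∃ M ⊆ A, #M = m ∧ ∃ g : ℕ → κ, ∀ x ∈ M, ∀ s ⊆ M, #s = k → (∀ y ∈ s, x < y) →
        c (insert x s) = g x := by
  induction m with
  | zero =>
    refine ⟨0, fun A _ c => ⟨∅, by simp, by simp, fun _ => Classical.arbitrary κ, by simp⟩⟩
  | succ m ih =>
    obtain ⟨n₀, h₀⟩ := ih
    obtain ⟨n₁, h₁⟩ := hk n₀
    refine ⟨n₁ + 1, fun A hA c => ?_⟩
    have hne : A.Nonempty := card_pos.1 (by omega)
    set x := A.min' hne with hx
    have hxA : x ∈ A := A.min'_mem hne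
    -- Over the minimum `x` of `A`, `c` colours `k`-sets; it is made constant on `M₁`, and the
    -- induction continues inside `M₁`.
    obtain ⟨M₁, hM₁, hc₁, a, ha⟩ := h₁ (A.erase x) (by rw [card_erase_of_mem hxA]; omega)
      (fun s => c (insert x s))
    obtain ⟨M, hM, hcM, g, hg⟩ := h₀ M₁ hc₁.ge c
    have hMA : M ⊆ A.erase x := hM.trans hM₁
    have hxM : x ∉ M := fun h => by simpa using hMA h
    have hlt : ∀ y ∈ M, x < y := fun y hy =>
      lt_of_le_of_ne (A.min'_le y (mem_of_mem_erase (hMA hy))) (fun h => hxM (h ▸ hy))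
    refine ⟨insert x M, insert_subset hxA (hMA.trans (erase_subset _ _)),
      by rw [card_insert_of_notMem hxM, hcM], Function.update g x a, ?_⟩
    intro y hy s hs hsk hys
    have hsM : s ⊆ M := by
      intro z hz
      rcases mem_insert.1 (hs hz) with rfl | h
      · rcases mem_insert.1 hy with rfl | h
        · exact absurd (hys _ hz) (lt_irrefl _)
        · exact absurd (hys _ hz) (not_lt.2 (hlt _ h).le)
      · exact h
    rcases mem_insert.1 hy with rfl | h
    · rw [Function.update_self]
      exact ha s (hsM.trans hM) hsk
    · rw [Function.update_of_ne (fun e : y = x => hxM (e ▸ h))]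
      exact hg y h s hsM hsk hys

open Finset in
/-- The finite Ramsey theorem for hypergraphs, for subsets of the natural numbers. -/
theorem exists_homogeneous (κ : Type*) [Fintype κ] [Nonempty κ] (k m : ℕ) :
    ∃ n, ∀ A : Finset ℕ, n ≤ #A → ∀ c : Finset ℕ → κ,
      ∃ M ⊆ A, #M = m ∧ ∃ a, ∀ s ⊆ M, #s = k → c s = a := by
  classical
  induction k generalizing m with
  | zero =>
    refine ⟨m, fun A hA c => ?_⟩
    obtain ⟨M, hM, hc⟩ := exists_subset_card_eq hA
    refine ⟨M, hM, hc, c ∅, fun s _ hs => ?_⟩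
    rw [card_eq_zero.1 hs]
  | succ k ih =>
    obtain ⟨n, hn⟩ := exists_min_homogeneous ih (Fintype.card κ * m)
    refine ⟨n, fun A hA c => ?_⟩
    obtain ⟨M, hM, hc, g, hg⟩ := hn A hA c
    obtain ⟨a, -, ha⟩ := exists_le_card_fiber_of_mul_le_card_of_maps_to
      (s := M) (t := univ) (f := g) (n := m) (fun _ _ => mem_univ _) univ_nonempty
      (by rw [hc, card_univ])
    obtain ⟨M', hM', hc'⟩ := exists_subset_card_eq ha
    have hM'M : M' ⊆ M := hM'.trans (filter_subset _ _)
    refine ⟨M', hM'M.trans hM, hc', a, fun s hs hsk => ?_⟩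
    have hne : s.Nonempty := card_pos.1 (by omega)
    have hmem := s.min'_mem hne
    rw [← insert_erase hmem, hg _ (hM'M (hs hmem)) _
      (((erase_subset _ _).trans hs).trans hM'M) (by rw [card_erase_of_mem hmem]; omega)
      (fun y hy => s.min'_lt_of_mem_erase_min' hne hy)]
    exact (mem_filter.1 (hM' (hs hmem))).2

open Finset in
/-- For a labelling of the finite sets, there is a large set in which the effect on the label of
deleting an element from a `D`-subset depends only on the position of this element. -/
theorem exists_position_homogeneous (D m : ℕ) :
    ∃ n, ∀ L : Finset ℕ → ℕ, ∃ t : ℕ → ℕ, StrictMono t ∧ (∀ i < m, t i < n) ∧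
      ∃ C : Finset ℕ, ∀ z ⊆ range m, #z = D → ∀ i ∈ z,
        (L ((z.erase i).image t) < L (z.image t) ↔ #(z.filter (· < i)) ∈ C) := by
  classical
  obtain ⟨n, hn⟩ := exists_homogeneous (Finset (Fin D)) D m
  refine ⟨n, fun L => ?_⟩
  -- The colour of a set is the set of positions at which deletion lowers the label.
  obtain ⟨M, hM, hc, a, ha⟩ := hn (range n) (by simp) (fun z => univ.filter fun p : Fin D =>
    ∃ i ∈ z, #(z.filter (· < i)) = p ∧ L (z.erase i) < L z)
  -- The values `n + i` only keep `t` strictly increasing beyond `m`.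
  let t : ℕ → ℕ := fun i => if h : i < m then M.orderEmbOfFin hc ⟨i, h⟩ else n + i
  have htM : ∀ i < m, t i ∈ M := fun i h => by
    simp only [t, dif_pos h]; exact M.orderEmbOfFin_mem hc _
  have htn : ∀ i < m, t i < n := fun i h => mem_range.1 (hM (htM i h))
  have hmono : StrictMono t := by
    intro i j hij
    by_cases hj : j < m
    · have hi := hij.trans hj
      simp only [t, dif_pos hj, dif_pos hi]
      exact (M.orderEmbOfFin hc).strictMono hij
    · by_cases hi : i < m
      · have := htn i hi
        simp only [t, dif_neg hj] at this ⊢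
        omega
      · simp only [t, dif_neg hj, dif_neg hi]
        omega
  refine ⟨t, hmono, htn, a.map Fin.valEmbedding, fun z hz hzD i hi => ?_⟩
  have hpos : ∀ j, #((z.image t).filter (· < t j)) = #(z.filter (· < j)) := by
    intro j
    rw [filter_image, card_image_of_injective _ hmono.injective]
    simp only [hmono.lt_iff_lt]
  have hinj : ∀ j ∈ z, #(z.filter (· < j)) = #(z.filter (· < i)) → j = i := by
    intro j hj h
    rcases lt_trichotomy j i with hl | hl | hl
    · refine absurd h (card_lt_card ⟨fun x hx => ?_, fun hs => ?_⟩).ne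
      · rw [mem_filter] at hx ⊢; exact ⟨hx.1, hx.2.trans hl⟩
      · simpa using hs (mem_filter.2 ⟨hj, hl⟩)
    · exact hl
    · refine absurd h (card_lt_card ⟨fun x hx => ?_, fun hs => ?_⟩).ne'
      · rw [mem_filter] at hx ⊢; exact ⟨hx.1, hx.2.trans hl⟩
      · simpa using hs (mem_filter.2 ⟨hi, hl⟩)
  have hlt : #(z.filter (· < i)) < D := by
    rw [← hzD]
    exact card_lt_card ⟨filter_subset _ _, fun hs => by simpa using hs hi⟩
  have haz := ha (z.image t) (by
    intro x hx
    obtain ⟨y, hy, rfl⟩ := mem_image.1 hx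
    exact htM y (mem_range.1 (hz hy))) (by rw [card_image_of_injective _ hmono.injective, hzD])
  have hmem : #(z.filter (· < i)) ∈ a.map Fin.valEmbedding ↔
      (⟨#(z.filter (· < i)), hlt⟩ : Fin D) ∈ a := by
    simp only [mem_map, Fin.valEmbedding_apply]
    constructor
    · rintro ⟨q, hq, h⟩
      convert hq
      exact h.symm
    · exact fun h => ⟨_, h, rfl⟩
  rw [hmem, ← haz, mem_filter, image_erase hmono.injective]
  constructor
  · intro h
    exact ⟨mem_univ _, t i, mem_image_of_mem _ hi, hpos i, h⟩
  · rintro ⟨-, x, hx, h1, h2⟩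
    obtain ⟨j, hj, rfl⟩ := mem_image.1 hx
    rw [hpos] at h1
    rwa [hinj j hj h1] at h2

/-! ### Transversals of pairs -/

theorem toNat_bool_injective : Function.Injective Bool.toNat := by decide

/-- The transversal of the pairs `{2 * q, 2 * q + 1}`, `q < N`, selected by `ε`. -/
def transversal (N : ℕ) (ε : ℕ → Bool) : Finset ℕ :=
  (Finset.range N).image fun q => 2 * q + (ε q).toNat

theorem mem_transversal {N : ℕ} {ε : ℕ → Bool} {v : ℕ} :
    v ∈ transversal N ε ↔ v / 2 < N ∧ v % 2 = (ε (v / 2)).toNat := by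
  simp only [transversal, Finset.mem_image, Finset.mem_range]
  constructor
  · rintro ⟨q, hq, rfl⟩
    have := Bool.toNat_lt (ε q)
    have h1 : (2 * q + (ε q).toNat) / 2 = q := by omega
    rw [h1]
    exact ⟨hq, by omega⟩
  · rintro ⟨h1, h2⟩
    exact ⟨v / 2, h1, by omega⟩

theorem card_transversal (N : ℕ) (ε : ℕ → Bool) : (transversal N ε).card = N := by
  rw [transversal, Finset.card_image_of_injective, Finset.card_range]
  intro q q' h
  have h1 := Bool.toNat_lt (ε q)
  have h2 := Bool.toNat_lt (ε q')
  simp only at h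
  omega

theorem transversal_subset {N M : ℕ} (h : N ≤ M) (ε : ℕ → Bool) :
    transversal N ε ⊆ Finset.range (2 * M) := by
  intro v hv
  have := (mem_transversal.1 hv).1
  rw [Finset.mem_range]
  omega

theorem mem_transversal_self {N q : ℕ} (hq : q < N) (ε : ℕ → Bool) :
    2 * q + (ε q).toNat ∈ transversal N ε :=
  Finset.mem_image_of_mem _ (Finset.mem_range.2 hq)

/-- The element chosen from the pair `q` has position `q`, whatever `ε` is. -/
theorem filter_lt_transversal {N q : ℕ} (hq : q < N) (ε : ℕ → Bool) :
    (transversal N ε).filter (· < 2 * q + (ε q).toNat) = transversal q ε := by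
  ext v
  have h := Bool.toNat_lt (ε q)
  rw [Finset.mem_filter, mem_transversal, mem_transversal]
  constructor
  · rintro ⟨⟨h1, h2⟩, h3⟩
    refine ⟨?_, h2⟩
    by_contra h4
    have h5 : v / 2 = q := by omega
    rw [h5] at h2
    omega
  · rintro ⟨h1, h2⟩
    exact ⟨⟨by omega, h2⟩, by omega⟩

/-- The right side does not involve `ε q`, so transversals differing only in the pair `q` have the
same deletion. The next lemma does this for insertions. -/
theorem mem_erase_transversal {N q v : ℕ} {ε : ℕ → Bool} :
    v ∈ (transversal N ε).erase (2 * q + (ε q).toNat) ↔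
      v / 2 ≠ q ∧ v / 2 < N ∧ v % 2 = (ε (v / 2)).toNat := by
  have h := Bool.toNat_lt (ε q)
  rw [Finset.mem_erase, mem_transversal]
  constructor
  · rintro ⟨h1, h2, h3⟩
    refine ⟨fun h4 => h1 ?_, h2, h3⟩
    rw [h4] at h3
    omega
  · rintro ⟨h1, h2, h3⟩
    exact ⟨by omega, h2, h3⟩

theorem mem_insert_transversal {N q v : ℕ} {ε : ℕ → Bool} (hq : q < N) :
    v ∈ insert (2 * q + (!ε q).toNat) (transversal N ε) ↔
      v / 2 = q ∨ (v / 2 < N ∧ v % 2 = (ε (v / 2)).toNat) := by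
  rw [Finset.mem_insert, mem_transversal]
  have h := Bool.toNat_lt (!ε q)
  constructor
  · rintro (h1 | h1)
    · exact Or.inl (by omega)
    · exact Or.inr h1
  · rintro (h1 | h1)
    · rcases Nat.mod_two_eq_zero_or_one v with h2 | h2 <;> cases h3 : ε q
      · right; rw [h1, h3]; exact ⟨hq, h2⟩
      · left; simp; omega
      · left; simp; omega
      · right; rw [h1, h3]; exact ⟨hq, h2⟩
    · exact Or.inr h1

/-- When both elements of the pair `q` are present, they have the positions `q` and `q + 1`; this is
why consecutive positions are needed. -/
theorem card_filter_lt_insert_transversal {N q : ℕ} (hq : q < N) (ε : ℕ → Bool) :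
    ((insert (2 * q + (!ε q).toNat) (transversal N ε)).filter
      (· < 2 * q + (!ε q).toNat)).card = q + (!ε q).toNat := by
  rw [Finset.filter_insert, if_neg (lt_irrefl _)]
  cases h3 : ε q
  · have : (transversal N ε).filter (· < 2 * q + (!false).toNat) =
        insert (2 * q + (ε q).toNat) (transversal q ε) := by
      rw [← filter_lt_transversal hq ε]
      ext v
      have := @mem_transversal_self N q hq ε
      rw [h3] at this ⊢
      simp only [Finset.mem_filter, Finset.mem_insert, Bool.not_false, Bool.toNat_true,
        Bool.toNat_false] at this ⊢
      constructor
      · rintro ⟨h1, h2⟩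
        by_cases h4 : v = 2 * q + 0
        · exact Or.inl h4
        · exact Or.inr ⟨h1, by omega⟩
      · rintro (rfl | ⟨h1, h2⟩)
        · exact ⟨this, by omega⟩
        · exact ⟨h1, by omega⟩
    rw [this, Finset.card_insert_of_notMem, card_transversal]
    · simp
    · rw [mem_transversal, h3]; simp
  · have : (transversal N ε).filter (· < 2 * q + (!true).toNat) = transversal q ε := by
      ext v
      simp only [Finset.mem_filter, mem_transversal, Bool.not_true, Bool.toNat_false]
      have hv := Bool.toNat_lt (ε (v / 2))
      constructor
      · rintro ⟨⟨h1, h2⟩, h4⟩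
        exact ⟨by omega, h2⟩
      · rintro ⟨h1, h2⟩
        exact ⟨⟨by omega, h2⟩, by omega⟩
    rw [this, card_transversal]
    simp

open Finset in
/-- The distance of two transversals, selected by extensions of points of a cube. -/
theorem card_symmDiff_transversal {m N : ℕ} {σ : Fin m → ℕ} (hσ : Function.Injective σ)
    (hN : ∀ a, σ a < N) (x y : Fin m → Bool) :
    #(symmDiff (transversal N (Function.extend σ x fun _ => false))
      (transversal N (Function.extend σ y fun _ => false))) = 2 * hammingDist x y := by
  have key : symmDiff (transversal N (Function.extend σ x fun _ => false))
      (transversal N (Function.extend σ y fun _ => false)) =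
      ((univ.filter fun a => x a ≠ y a) ×ˢ (univ : Finset Bool)).image
        fun u => 2 * σ u.1 + u.2.toNat := by
    ext v
    simp only [mem_symmDiff, mem_transversal, mem_image, mem_product, mem_filter, mem_univ,
      true_and, and_true, Prod.exists]
    by_cases hv : ∃ a, σ a = v / 2
    · obtain ⟨a, ha⟩ := hv
      have h2 : ∀ z : Fin m → Bool, Function.extend σ z (fun _ => false) (v / 2) = z a := by
        intro z; rw [← ha]; exact hσ.extend_apply _ _ _
      rw [h2, h2, ← ha]
      have hNa := hN a
      constructor
      · intro h
        refine ⟨a, decide (v % 2 = 1), ?_, ?_⟩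
        · intro e; rw [e] at h; tauto
        · rcases Nat.mod_two_eq_zero_or_one v with h3 | h3 <;> simp [h3] <;> omega
      · rintro ⟨b, s, h3, h4⟩
        have hs := Bool.toNat_lt s
        have : b = a := hσ (by omega)
        subst this
        have hne : (x b).toNat ≠ (y b).toNat := fun h => h3 (toNat_bool_injective h)
        have hx := Bool.toNat_lt (x b)
        have hy := Bool.toNat_lt (y b)
        omega
    · have h2 : ∀ z : Fin m → Bool, Function.extend σ z (fun _ => false) (v / 2) = false :=
        fun z => Function.extend_apply' _ _ _ hv
      rw [h2, h2]
      constructor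
      · tauto
      · rintro ⟨b, s, -, h4⟩
        have hs := Bool.toNat_lt s
        exact absurd ⟨b, by omega⟩ hv
  rw [key, card_image_of_injective, card_product, hammingDist]
  · simp [mul_comm]
  · rintro ⟨a, s⟩ ⟨b, s'⟩ h
    have h1 := Bool.toNat_lt s
    have h2 := Bool.toNat_lt s'
    simp only at h
    have h3 : a = b := hσ (by omega)
    subst h3
    have h4 : s = s' := toNat_bool_injective (by omega)
    rw [h4]

theorem exists_flip_of_hammingDist_eq_one {m : ℕ} {x y : Fin m → Bool}
    (h : hammingDist x y = 1) : ∃ a, y a = !x a ∧ ∀ b, b ≠ a → y b = x b := by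
  obtain ⟨a, ha⟩ := Finset.card_eq_one.1 h
  have hmem : ∀ b, x b ≠ y b ↔ b = a := by
    intro b
    have := Finset.ext_iff.1 ha b
    simpa using this
  refine ⟨a, ?_, fun b hb => ?_⟩
  · have := (hmem a).2 rfl
    cases hx : x a <;> cases hy : y a <;> simp_all
  · by_contra h
    exact hb ((hmem b).1 (Ne.symm h))

/-! ### A scaled cube with late midpoints -/

open Finset in
/-- Many positions are followed by one of the same set, if few positions are missing. -/
theorem le_card_consecutive {m : ℕ} {C : Finset ℕ} (h : #(range (3 * m) \ C) < m) :
    m ≤ #((range (3 * m - 1)).filter fun p => p ∈ C ∧ p + 1 ∈ C) := by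
  -- A missing position spoils only itself and its predecessor, so at most `2 * (m - 1)` positions
  -- are lost.
  have hsub : range (3 * m - 1) ⊆ ((range (3 * m - 1)).filter fun p => p ∈ C ∧ p + 1 ∈ C) ∪
      ((range (3 * m) \ C) ∪ (range (3 * m) \ C).image (· - 1)) := by
    intro p hp
    rw [mem_range] at hp
    simp only [mem_union, mem_filter, mem_range, mem_sdiff, mem_image]
    by_cases h1 : p ∈ C
    · by_cases h2 : p + 1 ∈ C
      · exact Or.inl ⟨hp, h1, h2⟩
      · exact Or.inr (Or.inr ⟨p + 1, ⟨by omega, h2⟩, by omega⟩)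
    · exact Or.inr (Or.inl ⟨by omega, h1⟩)
  have h1 := card_le_card hsub
  have h2 := card_union_le ((range (3 * m - 1)).filter fun p => p ∈ C ∧ p + 1 ∈ C)
    ((range (3 * m) \ C) ∪ (range (3 * m) \ C).image (· - 1))
  have h3 := card_union_le (range (3 * m) \ C) ((range (3 * m) \ C).image (· - 1))
  have h4 : #((range (3 * m) \ C).image (· - 1)) ≤ _ := card_image_le
  rw [card_range] at h1
  omega

/-- The point of the cube given by a set of coordinates. -/
def cubePoint (n : ℕ) (A : Finset ℕ) : Fin n → Bool := fun i => decide ((i : ℕ) ∈ A)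

open Finset in
theorem hammingDist_cubePoint {n : ℕ} {A B : Finset ℕ} (hA : A ⊆ range n) (hB : B ⊆ range n) :
    hammingDist (cubePoint n A) (cubePoint n B) = #(symmDiff A B) := by
  have : symmDiff A B = (univ.filter fun i => cubePoint n A i ≠ cubePoint n B i).map
      Fin.valEmbedding := by
    ext v
    simp only [mem_symmDiff, mem_map, mem_filter, mem_univ, true_and, cubePoint,
      Fin.valEmbedding_apply, ne_eq, decide_eq_decide]
    constructor
    · intro h
      have hv : v < n := by
        rcases h with h | h
        · exact mem_range.1 (hA h.1)
        · exact mem_range.1 (hB h.1)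
      exact ⟨⟨v, hv⟩, by simp only; tauto, rfl⟩
    · rintro ⟨i, hi, rfl⟩
      tauto
  rw [this, card_map, hammingDist]

open Finset in
theorem symmDiff_erase_self {A : Finset ℕ} {u : ℕ} (hu : u ∈ A) : symmDiff A (A.erase u) = {u} := by
  ext v
  simp only [mem_symmDiff, mem_erase, mem_singleton]
  constructor
  · tauto
  · rintro rfl; tauto

open Finset in
/-- In every labelled hypercube of large dimension there is a copy of the `m`-dimensional
hypercube, scaled by two, each edge of which has a midpoint with a label larger than those of its
ends. -/
theorem exists_scaled_cube (m : ℕ) :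
    ∃ n, ∀ l : (Fin n → Bool) → ℕ, Function.Injective l →
      ∃ ι : (Fin m → Bool) → (Fin n → Bool),
        (∀ x y, hammingDist (ι x) (ι y) = 2 * hammingDist x y) ∧
        ∀ x y, hammingDist x y = 1 → ∃ z, hammingDist (ι x) z = 1 ∧ hammingDist z (ι y) = 1 ∧
          l (ι x) < l z ∧ l (ι y) < l z := by
  set D := 3 * m with hD
  obtain ⟨n, hn⟩ := exists_position_homogeneous D (2 * D)
  refine ⟨n, fun l hl => ?_⟩
  obtain ⟨t, ht, htn, C, hC⟩ := hn fun A => l (cubePoint n A)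
  set J : Finset ℕ → Fin n → Bool := fun A => cubePoint n (A.image t) with hJ
  have hJd : ∀ A ⊆ range (2 * D), ∀ B ⊆ range (2 * D),
      hammingDist (J A) (J B) = #(symmDiff A B) := by
    have hsub : ∀ A ⊆ range (2 * D), A.image t ⊆ range n := by
      intro A hA v hv
      obtain ⟨i, hi, rfl⟩ := mem_image.1 hv
      exact mem_range.2 (htn i (mem_range.1 (hA hi)))
    intro A hA B hB
    rw [hammingDist_cubePoint (hsub A hA) (hsub B hB), ← image_symmDiff _ _ ht.injective,
      card_image_of_injective _ ht.injective]
  have hone : ∀ A ⊆ range (2 * D), ∀ u ∈ A,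
      hammingDist (J A) (J (A.erase u)) = 1 ∧ hammingDist (J (A.erase u)) (J A) = 1 := by
    intro A hA u hu
    have : hammingDist (J A) (J (A.erase u)) = 1 := by
      rw [hJd A hA _ ((erase_subset _ _).trans hA), symmDiff_erase_self hu, card_singleton]
    exact ⟨this, by rw [hammingDist_comm]; exact this⟩
  have hext : ∀ {σ : Fin m → ℕ}, Function.Injective σ → ∀ x y : Fin m → Bool, ∀ a,
      (∀ b, b ≠ a → y b = x b) → ∀ q, q ≠ σ a →
        Function.extend σ y (fun _ => false) q = Function.extend σ x (fun _ => false) q := by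
    intro σ hσ x y a hy q hq
    by_cases h : ∃ b, σ b = q
    · obtain ⟨b, rfl⟩ := h
      rw [hσ.extend_apply, hσ.extend_apply, hy b (fun e => hq (e ▸ rfl))]
    · rw [Function.extend_apply' _ _ _ h, Function.extend_apply' _ _ _ h]
  by_cases hcase : m ≤ #(range D \ C)
  -- Deletion does not lower the label at the positions in `P`: intersections serve as midpoints.
  · obtain ⟨P, hP, hPm⟩ := exists_subset_card_eq hcase
    set σ : Fin m → ℕ := fun a => P.orderEmbOfFin hPm a with hσd
    have hσ : Function.Injective σ := (P.orderEmbOfFin hPm).injective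
    have hσP : ∀ a, σ a < D ∧ σ a ∉ C := fun a => by
      simpa using hP (P.orderEmbOfFin_mem hPm a)
    have hlt : ∀ ε : ℕ → Bool, ∀ a, l (J (transversal D ε)) <
        l (J ((transversal D ε).erase (2 * σ a + (ε (σ a)).toNat))) := by
      intro ε a
      have hmem := mem_transversal_self (hσP a).1 ε
      have h1 := (hC _ (transversal_subset le_rfl ε) (card_transversal D ε) _ hmem).not.2 (by
        rw [filter_lt_transversal (hσP a).1, card_transversal]; exact (hσP a).2)
      -- Injectivity of the labels makes the inequality strict.
      refine lt_of_le_of_ne (not_lt.1 h1) (fun h => ?_)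
      have h2 := (hone _ (transversal_subset le_rfl ε) _ hmem).1
      rw [← hl h, hammingDist_self] at h2
      exact zero_ne_one h2
    refine ⟨fun x => J (transversal D (Function.extend σ x fun _ => false)), fun x y => ?_,
      fun x y hxy => ?_⟩
    · rw [hJd _ (transversal_subset le_rfl _) _ (transversal_subset le_rfl _)]
      exact card_symmDiff_transversal hσ (fun a => (hσP a).1) x y
    · obtain ⟨a, -, hy⟩ := exists_flip_of_hammingDist_eq_one hxy
      have heq := hext hσ x y a hy
      set ε := Function.extend σ x fun _ => false
      set ε' := Function.extend σ y fun _ => false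
      have hee : (transversal D ε').erase (2 * σ a + (ε' (σ a)).toNat) =
          (transversal D ε).erase (2 * σ a + (ε (σ a)).toNat) := by
        ext v
        rw [mem_erase_transversal, mem_erase_transversal]
        refine and_congr_right fun h => ?_
        rw [heq _ h]
      refine ⟨J ((transversal D ε).erase (2 * σ a + (ε (σ a)).toNat)),
        (hone _ (transversal_subset le_rfl ε) _ (mem_transversal_self (hσP a).1 ε)).1, ?_,
        hlt ε a, ?_⟩
      · rw [← hee]
        exact (hone _ (transversal_subset le_rfl ε') _ (mem_transversal_self (hσP a).1 ε')).2
      · rw [← hee]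
        exact hlt ε' a
  -- Unions serve as midpoints. One pair fewer is used, so that the unions have `D` elements.
  · obtain ⟨P, hP, hPm⟩ := exists_subset_card_eq (le_card_consecutive (not_le.1 hcase))
    set σ : Fin m → ℕ := fun a => P.orderEmbOfFin hPm a with hσd
    have hσ : Function.Injective σ := (P.orderEmbOfFin hPm).injective
    have hσP : ∀ a, σ a < D - 1 ∧ σ a ∈ C ∧ σ a + 1 ∈ C := fun a => by
      simpa using hP (P.orderEmbOfFin_mem hPm a)
    have hZ : ∀ ε : ℕ → Bool, ∀ a,
        insert (2 * σ a + (!ε (σ a)).toNat) (transversal (D - 1) ε) ⊆ range (2 * D) ∧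
        2 * σ a + (!ε (σ a)).toNat ∉ transversal (D - 1) ε := by
      intro ε a
      have h1 := Bool.toNat_lt (!ε (σ a))
      have h2 := (hσP a).1
      refine ⟨insert_subset (mem_range.2 (by omega)) (transversal_subset (by omega) ε), ?_⟩
      rw [mem_transversal]
      have h3 : (2 * σ a + (!ε (σ a)).toNat) / 2 = σ a := by omega
      rw [h3]
      cases ε (σ a) <;> simp
    have hlt : ∀ ε : ℕ → Bool, ∀ a, l (J (transversal (D - 1) ε)) <
        l (J (insert (2 * σ a + (!ε (σ a)).toNat) (transversal (D - 1) ε))) := by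
      intro ε a
      have h1 := (hC _ (hZ ε a).1 (by
        rw [card_insert_of_notMem (hZ ε a).2, card_transversal]
        have := (hσP a).1
        omega) _ (mem_insert_self _ _)).2 (by
          rw [card_filter_lt_insert_transversal (hσP a).1]
          cases ε (σ a)
          · exact (hσP a).2.2
          · exact (hσP a).2.1)
      rwa [erase_insert (hZ ε a).2] at h1
    have hdist : ∀ ε : ℕ → Bool, ∀ a,
        hammingDist (J (transversal (D - 1) ε))
          (J (insert (2 * σ a + (!ε (σ a)).toNat) (transversal (D - 1) ε))) = 1 ∧
        hammingDist (J (insert (2 * σ a + (!ε (σ a)).toNat) (transversal (D - 1) ε)))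
          (J (transversal (D - 1) ε)) = 1 := by
      intro ε a
      have := hone _ (hZ ε a).1 _ (mem_insert_self _ _)
      rw [erase_insert (hZ ε a).2] at this
      exact this.symm
    refine ⟨fun x => J (transversal (D - 1) (Function.extend σ x fun _ => false)), fun x y => ?_,
      fun x y hxy => ?_⟩
    · rw [hJd _ (transversal_subset (by omega) _) _ (transversal_subset (by omega) _)]
      exact card_symmDiff_transversal hσ (fun a => (hσP a).1) x y
    · obtain ⟨a, -, hy⟩ := exists_flip_of_hammingDist_eq_one hxy
      have heq := hext hσ x y a hy
      set ε := Function.extend σ x fun _ => false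
      set ε' := Function.extend σ y fun _ => false
      have hee : insert (2 * σ a + (!ε' (σ a)).toNat) (transversal (D - 1) ε') =
          insert (2 * σ a + (!ε (σ a)).toNat) (transversal (D - 1) ε) := by
        ext v
        rw [mem_insert_transversal (hσP a).1, mem_insert_transversal (hσP a).1]
        by_cases h : v / 2 = σ a
        · simp [h]
        · rw [heq _ h]
      refine ⟨J (insert (2 * σ a + (!ε (σ a)).toNat) (transversal (D - 1) ε)),
        (hdist ε a).1, ?_, hlt ε a, ?_⟩
      · rw [← hee]
        exact (hdist ε' a).2
      · rw [← hee]
        exact hlt ε' a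

/-! ### Isometric zig-zag paths -/

theorem hammingDist_le_sub {n N : ℕ} {p : ℕ → Fin n → Bool}
    (hp : ∀ i < N, hammingDist (p i) (p (i + 1)) = 1) (i d : ℕ) (h : i + d ≤ N) :
    hammingDist (p i) (p (i + d)) ≤ d := by
  induction d with
  | zero => simp
  | succ d ih =>
    have h1 := ih (by omega)
    have h2 := hp (i + d) (by omega)
    have h3 := hammingDist_triangle (p i) (p (i + d)) (p (i + (d + 1)))
    rw [← add_assoc] at h3 ⊢
    omega

/-- A walk whose ends are as far apart as its length allows is isometric. -/
theorem hammingDist_eq_dist {n N : ℕ} {p : ℕ → Fin n → Bool}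
    (hp : ∀ i < N, hammingDist (p i) (p (i + 1)) = 1) (hN : hammingDist (p 0) (p N) = N)
    {a b : ℕ} (ha : a ≤ N) (hb : b ≤ N) : hammingDist (p a) (p b) = Nat.dist a b := by
  wlog hab : a ≤ b generalizing a b
  · rw [hammingDist_comm, Nat.dist_comm]
    exact this hb ha (by omega)
  rw [Nat.dist_eq_sub_of_le hab]
  have h1 := hammingDist_le_sub hp 0 a (by omega)
  have h2 := hammingDist_le_sub hp a (b - a) (by omega)
  have h3 := hammingDist_le_sub hp b (N - b) (by omega)
  have h4 := hammingDist_triangle (p 0) (p a) (p N)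
  have h5 := hammingDist_triangle (p a) (p b) (p N)
  rw [zero_add] at h1
  rw [Nat.add_sub_cancel' hab] at h2
  rw [Nat.add_sub_cancel' hb] at h3
  omega

theorem gcd_two_pow_of_odd {a : ℕ} (h : a % 2 = 1) (r : ℕ) : Nat.gcd a (2 ^ r) = 1 :=
  Nat.Coprime.pow_right r (Nat.coprime_two_right.2 (Nat.odd_iff.2 h))

/-- When the path is doubled, the position `a` becomes `2 * a` and its distance from its parents
doubles too. -/
theorem gcd_two_mul_two_pow (a r : ℕ) :
    Nat.gcd (2 * a) (2 ^ (r + 1)) = 2 * Nat.gcd a (2 ^ r) := by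
  rw [pow_succ', Nat.gcd_mul_left]

/-- Every labelled hypercube of large dimension has an isometric zig-zag path of length `2 ^ r`.
The parents of the position `a` are those at distance `gcd a (2 ^ r)`. -/
theorem exists_zigzag_walk (r : ℕ) :
    ∃ n, ∀ l : (Fin n → Bool) → ℕ, Function.Injective l → ∃ p : ℕ → Fin n → Bool,
      (∀ i < 2 ^ r, hammingDist (p i) (p (i + 1)) = 1) ∧
      hammingDist (p 0) (p (2 ^ r)) = 2 ^ r ∧
      ∀ a ≤ 2 ^ r, ∀ b ≤ 2 ^ r, Nat.gcd a (2 ^ r) < 2 ^ r →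
        Nat.dist a b = Nat.gcd a (2 ^ r) → l (p b) < l (p a) := by
  induction r with
  | zero =>
    refine ⟨1, fun l _ => ⟨fun i _ => decide (i ≠ 0), ?_, ?_, ?_⟩⟩
    · intro i hi
      have : i = 0 := by simpa using hi
      subst this
      decide
    · decide
    · simp
  | succ r ih =>
    obtain ⟨m, hm⟩ := ih
    obtain ⟨n, hn⟩ := exists_scaled_cube m
    refine ⟨n, fun l hl => ?_⟩
    obtain ⟨ι, hι, hmid⟩ := hn l hl
    have hιinj : Function.Injective ι := by
      intro x y h
      have := hι x y
      rw [h, hammingDist_self] at this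
      exact hammingDist_eq_zero.1 (by omega)
    -- The labels are pulled back along `ι`, so the even positions of the new path inherit their
    -- zig-zag relations.
    obtain ⟨q, hq1, hq2, hq3⟩ := hm (l ∘ ι) (hl.comp hιinj)
    have hex : ∀ i, ∃ z, i < 2 ^ r → hammingDist (ι (q i)) z = 1 ∧
        hammingDist z (ι (q (i + 1))) = 1 ∧ l (ι (q i)) < l z ∧ l (ι (q (i + 1))) < l z := by
      intro i
      by_cases hi : i < 2 ^ r
      · obtain ⟨z, hz⟩ := hmid _ _ (hq1 i hi)
        exact ⟨z, fun _ => hz⟩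
      · exact ⟨ι (q i), fun h => absurd h hi⟩
    choose z hz using hex
    -- Odd positions carry the midpoints, whose parents are their two neighbours.
    set p : ℕ → Fin n → Bool := fun i => if i % 2 = 0 then ι (q (i / 2)) else z (i / 2) with hp
    have heven : ∀ i, p (2 * i) = ι (q i) := by
      intro i
      simp only [hp]
      rw [if_pos (by omega), Nat.mul_div_cancel_left _ two_pos]
    have hodd : ∀ i, p (2 * i + 1) = z i := by
      intro i
      simp only [hp]
      rw [if_neg (by omega)]
      congr 1
      omega
    have hpow : 2 ^ (r + 1) = 2 * 2 ^ r := pow_succ' _ _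
    refine ⟨p, fun i hi => ?_, ?_, fun a ha b hb hlt hd => ?_⟩
    · rcases Nat.even_or_odd' i with ⟨k, rfl | rfl⟩
      · rw [heven, hodd]
        exact (hz k (by omega)).1
      · have : 2 * k + 1 + 1 = 2 * (k + 1) := by ring
        rw [this, heven, hodd]
        exact (hz k (by omega)).2.1
    · rw [hpow, heven, show p 0 = ι (q 0) from heven 0, hι, hq2]
    · rcases Nat.even_or_odd' a with ⟨k, rfl | rfl⟩
      · rw [gcd_two_mul_two_pow] at hlt hd
        rcases Nat.even_or_odd' b with ⟨k', rfl | rfl⟩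
        · rw [heven, heven]
          refine hq3 k (by omega) k' (by omega) (by omega) ?_
          simp only [Nat.dist] at hd ⊢
          omega
        · simp only [Nat.dist] at hd
          omega
      · rw [gcd_two_pow_of_odd (by omega)] at hd
        have hk := hz k (by omega)
        have hb' : b = 2 * k ∨ b = 2 * (k + 1) := by
          simp only [Nat.dist] at hd
          omega
        rw [hodd]
        rcases hb' with rfl | rfl
        · rw [heven]; exact hk.2.2.1
        · rw [heven]; exact hk.2.2.2

theorem gcd_eq_two_pow_of_mod {a r i : ℕ} (hi : i ≤ r) (h1 : a % 2 ^ i = 0)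
    (h2 : a % 2 ^ (i + 1) ≠ 0) : Nat.gcd a (2 ^ r) = 2 ^ i := by
  obtain ⟨e, -, hge⟩ := (Nat.dvd_prime_pow Nat.prime_two).1 (Nat.gcd_dvd_right a (2 ^ r))
  have h3 : 2 ^ i ∣ 2 ^ e := hge ▸ Nat.dvd_gcd (Nat.dvd_of_mod_eq_zero h1) (pow_dvd_pow 2 hi)
  have h4 := (Nat.pow_dvd_pow_iff_le_right (by norm_num)).1 h3
  have h5 : ¬ i + 1 ≤ e := fun h => h2 (Nat.mod_eq_zero_of_dvd
    ((pow_dvd_pow 2 h).trans (hge ▸ Nat.gcd_dvd_left a (2 ^ r))))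
  rw [hge, show e = i by omega]

theorem isZigZag_of_gcd {r : ℕ} {l : Fin (2 ^ r + 1) → ℕ}
    (h : ∀ a b : Fin (2 ^ r + 1), Nat.gcd a (2 ^ r) < 2 ^ r →
      Nat.dist a b = Nat.gcd a (2 ^ r) → l b < l a) : IsZigZag l := by
  intro j hj hjr a h1 h2 b hb
  have hg := gcd_eq_two_pow_of_mod (Nat.sub_le r j) h1 h2
  exact h a b (by rw [hg]; exact Nat.pow_lt_pow_right (by norm_num) (by omega)) (hb.trans hg.symm)

theorem exists_zigzag_path (r : ℕ) :
    ∃ n, ∀ l : (Fin n → Bool) → ℕ, Function.Injective l →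
      ∃ p : Fin (2 ^ r + 1) → Fin n → Bool, IsIsometricPath p ∧
        ∀ a b : Fin (2 ^ r + 1), Nat.gcd a (2 ^ r) < 2 ^ r →
          Nat.dist a b = Nat.gcd a (2 ^ r) → l (p b) < l (p a) := by
  obtain ⟨n, hn⟩ := exists_zigzag_walk r
  refine ⟨n, fun l hl => ?_⟩
  obtain ⟨p, h1, h2, h3⟩ := hn l hl
  exact ⟨fun a => p a, fun a b => hammingDist_eq_dist h1 h2 a.is_le b.is_le,
    fun a b => h3 a a.is_le b b.is_le⟩

/-- A position is labelled earlier than all positions that are closer to it than its parents. -/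
theorem label_lt_of_dist_lt {r : ℕ} {l : Fin (2 ^ r + 1) → ℕ}
    (h : ∀ a b : Fin (2 ^ r + 1), Nat.gcd a (2 ^ r) < 2 ^ r →
      Nat.dist a b = Nat.gcd a (2 ^ r) → l b < l a) (a c : Fin (2 ^ r + 1)) (hac : a ≠ c)
    (hd : Nat.dist a c < Nat.gcd a (2 ^ r)) : l a < l c := by
  induction hδ : Nat.dist a c using Nat.strong_induction_on generalizing c with
  | _ δ ih =>
    have hne : (a : ℕ) ≠ c := fun e => hac (Fin.ext e)
    have hδ0 : 0 < Nat.dist a c := by simp only [Nat.dist]; omega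
    have hdvd : ∀ g : ℕ, g ∣ a → g ∣ c → g ≤ Nat.dist a c := fun g ha hc =>
      Nat.le_of_dvd hδ0 (Nat.dvd_add (Nat.dvd_sub ha hc) (Nat.dvd_sub hc ha))
    obtain ⟨i, hi, hgi⟩ := (Nat.dvd_prime_pow Nat.prime_two).1 (Nat.gcd_dvd_right a (2 ^ r))
    obtain ⟨k, hk, hgk⟩ := (Nat.dvd_prime_pow Nat.prime_two).1 (Nat.gcd_dvd_right c (2 ^ r))
    -- Otherwise `2 ^ i` divides both positions, which are then at least `gcd a (2 ^ r)` apart.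
    have hki : k < i := by
      by_contra hik
      have : 2 ^ i ∣ (c : ℕ) := (pow_dvd_pow 2 (not_lt.1 hik)).trans (hgk ▸ Nat.gcd_dvd_left _ _)
      have := hdvd (2 ^ i) (hgi ▸ Nat.gcd_dvd_left _ _) this
      omega
    have hle : 2 ^ k ≤ Nat.dist a c := hdvd _
      ((pow_dvd_pow 2 hki.le).trans (hgi ▸ Nat.gcd_dvd_left _ _)) (hgk ▸ Nat.gcd_dvd_left _ _)
    have hlt : Nat.gcd c (2 ^ r) < 2 ^ r := by
      rw [hgk]; exact Nat.pow_lt_pow_right (by norm_num) (by omega)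
    have hpos : 0 < 2 ^ k := by positivity
    have ha := a.is_lt
    have hc := c.is_lt
    -- The parent `b` of `c` on the side of `a` is earlier than `c` and nearer to `a`; it does not
    -- overshoot, by `hle`.
    obtain ⟨b, hbc, hab⟩ : ∃ b : Fin (2 ^ r + 1), Nat.dist c b = 2 ^ k ∧
        Nat.dist a b = Nat.dist a c - 2 ^ k := by
      simp only [Nat.dist] at hle ⊢
      rcases lt_or_gt_of_ne hne with hl | hl
      · exact ⟨⟨c - 2 ^ k, by omega⟩, by simp only; omega, by simp only; omega⟩
      · exact ⟨⟨c + 2 ^ k, by omega⟩, by simp only; omega, by simp only; omega⟩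
    have hb := h c b hlt (hbc.trans hgk.symm)
    by_cases hab' : a = b
    · exact hab' ▸ hb
    · exact (ih _ (by omega) b hab' (by omega) rfl).trans hb

/-! ### Potentials, ordered protocols and tree routings -/

/-- Telescoping. It bounds the price of a deviation when `w` gives the shares, and the optimum when
`w` gives the costs. -/
theorem SimpleGraph.Walk.sub_le_sum_edges {V : Type*} {G : SimpleGraph V} (f : V → ℝ)
    (w : Sym2 V → ℝ) {u v : V} (q : G.Walk u v)
    (h : ∀ x y, s(x, y) ∈ q.edges → f y - f x ≤ w s(x, y)) :
    f v - f u ≤ (q.edges.map w).sum := by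
  induction q with
  | nil => simp
  | @cons u x v hux q ih =>
    rw [SimpleGraph.Walk.edges_cons] at h ⊢
    rw [List.map_cons, List.sum_cons]
    have h1 := h u x List.mem_cons_self
    have h2 := ih fun y z hyz => h y z (List.mem_cons_of_mem _ hyz)
    linarith

theorem SimpleGraph.Path.sub_le_sum_edges {V : Type*} [DecidableEq V] {G : SimpleGraph V}
    (f : V → ℝ) (w : Sym2 V → ℝ) {u v : V} (q : G.Path u v)
    (h : ∀ x y, s(x, y) ∈ q.1.edges → f y - f x ≤ w s(x, y)) :
    f v - f u ≤ ∑ e ∈ q.1.edges.toFinset, w e := by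
  rw [List.sum_toFinset _ q.2.isTrail.edges_nodup]
  exact q.1.sub_le_sum_edges f w h

namespace GWSP

variable {V : Type*} [DecidableEq V]

/-- In an ordered protocol the first user of an edge pays for it. -/
theorem IsOrdered.toProtocol_apply {Ξ : GWSP V} (hΞ : Ξ.IsOrdered) (N : Network V) (e : Sym2 V)
    {R : Finset V} {i : V} (hi : i ∈ R) :
    Ξ.toProtocol N e R i = if ∀ j ∈ R, Ξ.rank i ≤ Ξ.rank j then N.cost e else 0 := by
  have hmem : i ∈ Ξ.firstBlock R ↔ ∀ j ∈ R, Ξ.rank i ≤ Ξ.rank j := by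
    simp [firstBlock, hi]
  unfold toProtocol
  by_cases h : ∀ j ∈ R, Ξ.rank i ≤ Ξ.rank j
  · rw [if_pos (hmem.2 h), if_pos h]
    have : Ξ.firstBlock R = {i} := by
      ext j
      rw [Finset.mem_singleton]
      constructor
      · intro hj
        have hj' := Finset.mem_filter.1 hj
        exact hΞ (le_antisymm (hj'.2 i hi) (h j hj'.1))
      · rintro rfl
        exact hmem.2 h
    rw [this, Finset.sum_singleton, div_self (Ξ.weight_pos i).ne', one_mul]
  · rw [if_neg (fun hc => h (hmem.1 hc)), if_neg h]

end GWSP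

namespace Network

variable {V : Type*} (N : Network V)

theorem mem_users [DecidableEq V] {S : Finset V} {P : N.Profile S} {e : Sym2 V} {x : V} :
    x ∈ N.users P e ↔ ∃ h : x ∈ S, e ∈ (P ⟨x, h⟩).1.edges := by
  simp [users]

theorem cost_nonneg_of_mem_edges {u v : V} {q : N.graph.Walk u v} {e : Sym2 V}
    (he : e ∈ q.edges) : 0 ≤ N.cost e :=
  N.cost_nonneg e (q.edges_subset_edgeSet he)

theorem cost_nonneg_of_mem_outcome [DecidableEq V] {S : Finset V} {P : N.Profile S} {e : Sym2 V}
    (he : e ∈ Finset.univ.biUnion (fun i : S => (P i).1.edges.toFinset)) : 0 ≤ N.cost e := by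
  obtain ⟨i, -, hi⟩ := Finset.mem_biUnion.1 he
  exact N.cost_nonneg_of_mem_edges (List.mem_toFinset.1 hi)

theorem socialCost_nonneg [DecidableEq V] {S : Finset V} (P : N.Profile S) : 0 ≤ N.socialCost P :=
  Finset.sum_nonneg fun _ he => N.cost_nonneg_of_mem_outcome he

theorem opt_le_socialCost [DecidableEq V] {S : Finset V} (P : N.Profile S) : N.opt S ≤ N.socialCost P :=
  ciInf_le ⟨0, by rintro _ ⟨Q, rfl⟩; exact N.socialCost_nonneg Q⟩ P

theorem sum_path_le_socialCost [DecidableEq V] {S : Finset V} (P : N.Profile S) (i : S) :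
    ∑ e ∈ (P i).1.edges.toFinset, N.cost e ≤ N.socialCost P :=
  Finset.sum_le_sum_of_subset_of_nonneg
    (Finset.subset_biUnion_of_mem (fun i : S => (P i).1.edges.toFinset) (Finset.mem_univ i))
    fun _ he _ => N.cost_nonneg_of_mem_outcome he

theorem ofReal_div_le_priceOfAnarchy [DecidableEq V] {ξ : CostSharingProtocol V} {S : Finset V}
    {P : N.Profile S} (hP : N.IsNash ξ P) (hopt : 0 < N.opt S) :
    ENNReal.ofReal (N.socialCost P / N.opt S) ≤ N.priceOfAnarchy ξ S := by
  rw [ENNReal.ofReal_div_of_pos hopt]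
  exact le_iSup (fun P : {P : N.Profile S // N.IsNash ξ P} =>
    ENNReal.ofReal (N.socialCost P.1) / ENNReal.ofReal (N.opt S)) ⟨P, hP⟩

variable {ι : Type*} (p : ι → V) (par : ι → Option ι)

/-- The edge from the vertex `p a` to its parent, which is the root if `par a = none`. -/
def parentEdge (a : ι) : Sym2 V := s(p a, (par a).elim N.root p)

/-- The paths `T x` follow the tree that is given by the parents. All vertices outside the range
of `p` are joined directly to the root. -/
structure IsRouting (T : ∀ x, N.graph.Path x N.root) : Prop where
  edges_apply : ∀ a, (T (p a)).1.edges =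
    N.parentEdge p par a :: (par a).elim [] fun b => (T (p b)).1.edges
  edges_of_notMem : ∀ x, (∀ a, p a ≠ x) → x ≠ N.root → (T x).1.edges = [s(x, N.root)]

/-- The walk to the root along the parents. -/
def parentWalk {N : Network V} {p : ι → V} {par : ι → Option ι} {κ : ι → ℕ}
    (hroot : ∀ a, N.graph.Adj (p a) N.root)
    (hadj : ∀ a b, par a = some b → N.graph.Adj (p a) (p b))
    (hκ : ∀ a b, par a = some b → κ b < κ a) (a : ι) : N.graph.Walk (p a) N.root :=
  match h : par a with
  | none => .cons (hroot a) .nil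
  | some b =>
    have := hκ a b h
    .cons (hadj a b h) (parentWalk hroot hadj hκ b)
termination_by κ a

variable {N p par} {κ : ι → ℕ}

theorem edges_parentWalk (hroot : ∀ a, N.graph.Adj (p a) N.root)
    (hadj : ∀ a b, par a = some b → N.graph.Adj (p a) (p b))
    (hκ : ∀ a b, par a = some b → κ b < κ a) (a : ι) :
    (parentWalk hroot hadj hκ a).edges = N.parentEdge p par a ::
      (par a).elim [] fun b => (parentWalk hroot hadj hκ b).edges := by
  rw [parentWalk]
  split
  · next h => simp [h, parentEdge]
  · next b h => simp [h, parentEdge]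

/-- `κ` drops strictly towards the parents, so no vertex is repeated; the bound on the support
carries the induction. -/
theorem isPath_parentWalk (hp : Function.Injective p) (hroot : ∀ a, N.graph.Adj (p a) N.root)
    (hadj : ∀ a b, par a = some b → N.graph.Adj (p a) (p b))
    (hκ : ∀ a b, par a = some b → κ b < κ a) (a : ι) :
    (parentWalk hroot hadj hκ a).IsPath ∧
      ∀ b, p b ∈ (parentWalk hroot hadj hκ a).support → κ b ≤ κ a := by
  induction hk : κ a using Nat.strong_induction_on generalizing a with
  | _ k ih =>
    rw [parentWalk]
    split
    · next h =>
      refine ⟨by simp [SimpleGraph.Walk.cons_isPath_iff, (hroot a).ne], fun b hb => ?_⟩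
      simp only [SimpleGraph.Walk.support_cons, SimpleGraph.Walk.support_nil, List.mem_cons,
        List.not_mem_nil, or_false] at hb
      rcases hb with hb | hb
      · rw [hp hb, hk]
      · exact absurd hb (hroot b).ne
    · next b h =>
      have hlt := hκ a b h
      obtain ⟨h1, h2⟩ := ih (κ b) (hk ▸ hlt) b rfl
      refine ⟨?_, fun c hc => ?_⟩
      · rw [SimpleGraph.Walk.cons_isPath_iff]
        exact ⟨h1, fun hc => absurd (h2 a hc) (not_le.2 hlt)⟩
      · rw [SimpleGraph.Walk.support_cons, List.mem_cons] at hc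
        rcases hc with hc | hc
        · rw [hp hc, hk]
        · have := h2 c hc
          omega

theorem exists_isRouting (hG : ∀ x y, x ≠ y → N.graph.Adj x y) (hp : Function.Injective p)
    (hroot : ∀ a, p a ≠ N.root) (hκ : ∀ a b, par a = some b → κ b < κ a) :
    ∃ T, N.IsRouting p par T := by
  have hroot' : ∀ a, N.graph.Adj (p a) N.root := fun a => hG _ _ (hroot a)
  have hadj : ∀ a b, par a = some b → N.graph.Adj (p a) (p b) := fun a b h =>
    hG _ _ fun e => (hκ a b h).ne (congrArg κ (hp e)).symm
  have hex : ∀ x, ∃ q : N.graph.Path x N.root,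
      (∀ a, p a = x → q.1.edges = (parentWalk hroot' hadj hκ a).edges) ∧
      ((∀ a, p a ≠ x) → x ≠ N.root → q.1.edges = [s(x, N.root)]) := by
    intro x
    by_cases hx : ∃ a, p a = x
    · obtain ⟨a, rfl⟩ := hx
      refine ⟨⟨parentWalk hroot' hadj hκ a, (isPath_parentWalk hp hroot' hadj hκ a).1⟩,
        fun b hb => ?_, fun h => absurd rfl (h a)⟩
      rw [hp hb]
    · by_cases hxr : x = N.root
      · subst hxr
        exact ⟨SimpleGraph.Path.nil, fun a ha => absurd ha (hroot a), fun _ h => absurd rfl h⟩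
      · exact ⟨SimpleGraph.Path.singleton (hG _ _ hxr), fun a ha => absurd ⟨a, ha⟩ hx,
          fun _ _ => by simp [SimpleGraph.Path.singleton]⟩
  choose T hT1 hT2 using hex
  refine ⟨T, fun a => ?_, hT2⟩
  rw [hT1 _ a rfl, edges_parentWalk]
  cases h : par a with
  | none => rfl
  | some b => simp only [Option.elim_some]; rw [hT1 _ b rfl]

namespace IsRouting

variable {T : ∀ x, N.graph.Path x N.root}

theorem parentEdge_mem (hT : N.IsRouting p par T) (a : ι) :
    N.parentEdge p par a ∈ (T (p a)).1.edges := by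
  rw [hT.edges_apply]; exact List.mem_cons_self

theorem exists_of_mem_edges (hT : N.IsRouting p par T)
    (hκ : ∀ a b, par a = some b → κ b < κ a) (a : ι) {e : Sym2 V}
    (he : e ∈ (T (p a)).1.edges) :
    ∃ b, (b = a ∨ κ b < κ a) ∧ e = N.parentEdge p par b := by
  induction hk : κ a using Nat.strong_induction_on generalizing a with
  | _ k ih =>
    rw [hT.edges_apply, List.mem_cons] at he
    rcases he with he | he
    · exact ⟨a, Or.inl rfl, he⟩
    · cases h : par a with
      | none => simp [h] at he
      | some b =>
        have hlt := hκ a b h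
        rw [h, Option.elim_some] at he
        obtain ⟨c, hc, hce⟩ := ih (κ b) (hk ▸ hlt) b he rfl
        refine ⟨c, Or.inr ?_, hce⟩
        rcases hc with rfl | hc <;> omega

end IsRouting

/-- Distinct vertices with the same parent edge would be parents of each other, against `κ`. Hence
costs can be summed over vertices. -/
theorem parentEdge_injective (hp : Function.Injective p) (hroot : ∀ a, p a ≠ N.root)
    (hκ : ∀ a b, par a = some b → κ b < κ a) : Function.Injective (N.parentEdge p par) := by
  have hpar : ∀ a b, p a = (par b).elim N.root p → κ a < κ b := by
    intro a b h
    cases hb : par b with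
    | none => rw [hb] at h; exact absurd h (hroot a)
    | some c =>
      rw [hb, Option.elim_some] at h
      rw [hp h]
      exact hκ b c hb
  intro a b h
  rcases Sym2.eq_iff.1 h with ⟨h1, -⟩ | ⟨h1, h2⟩
  · exact hp h1
  · have := hpar a b h1
    have := hpar b a h2.symm
    omega

namespace IsRouting

variable {T : ∀ x, N.graph.Path x N.root} {S E : Finset V}

theorem sum_le_socialCost [DecidableEq V] [Fintype ι] (hT : N.IsRouting p par T) (hp : Function.Injective p)
    (hroot : ∀ a, p a ≠ N.root) (hκ : ∀ a b, par a = some b → κ b < κ a)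
    (hS : ∀ a, p a ∈ S) :
    ∑ a, N.cost (N.parentEdge p par a) ≤ N.socialCost (S := S) fun i => T i := by
  rw [← Finset.sum_image (f := N.cost) (g := N.parentEdge p par)
    fun a _ b _ h => parentEdge_injective hp hroot hκ h]
  refine Finset.sum_le_sum_of_subset_of_nonneg ?_ fun _ he _ => N.cost_nonneg_of_mem_outcome he
  intro e he
  obtain ⟨a, -, rfl⟩ := Finset.mem_image.1 he
  exact Finset.mem_biUnion.2
    ⟨⟨p a, hS a⟩, Finset.mem_univ _, List.mem_toFinset.2 (hT.parentEdge_mem a)⟩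

/-- The players in `E` add only edges of cost zero, which are filtered out. -/
theorem socialCost_le_sum [DecidableEq V] [Fintype ι] (hT : N.IsRouting p par T) (hp : Function.Injective p)
    (hroot : ∀ a, p a ≠ N.root) (hκ : ∀ a b, par a = some b → κ b < κ a)
    (hS : ∀ x ∈ S, (∃ a, p a = x) ∨ x ∈ E)
    (hE : ∀ x ∈ E, x ≠ N.root ∧ (∀ a, p a ≠ x) ∧ N.cost s(x, N.root) = 0) :
    N.socialCost (S := S) (fun i => T i) ≤ ∑ a, N.cost (N.parentEdge p par a) := by
  rw [← Finset.sum_image (f := N.cost) (g := N.parentEdge p par)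
    fun a _ b _ h => parentEdge_injective hp hroot hκ h, socialCost, ← Finset.sum_filter_ne_zero]
  refine Finset.sum_le_sum_of_subset_of_nonneg ?_ fun e he _ => ?_
  · intro e he
    obtain ⟨he, hne⟩ := Finset.mem_filter.1 he
    obtain ⟨⟨x, hx⟩, -, he⟩ := Finset.mem_biUnion.1 he
    rw [List.mem_toFinset] at he
    rcases hS x hx with ⟨a, rfl⟩ | hxE
    · obtain ⟨b, -, rfl⟩ := hT.exists_of_mem_edges hκ a he
      exact Finset.mem_image_of_mem _ (Finset.mem_univ b)
    · obtain ⟨h1, h2, h3⟩ := hE x hxE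
      simp only [hT.edges_of_notMem x h2 h1, List.mem_singleton] at he
      exact absurd (he ▸ h3) hne
  · obtain ⟨a, -, rfl⟩ := Finset.mem_image.1 he
    exact N.cost_nonneg_of_mem_edges (hT.parentEdge_mem a)

/-- A tree routing is an equilibrium of an ordered protocol if parents come first, and if for each
player there is a potential which bounds the price of a detour. -/
theorem isNash [DecidableEq V] {Ξ : GWSP V} (hΞ : Ξ.IsOrdered) (hT : N.IsRouting p par T)
    (hκ : ∀ a b, par a = some b → Ξ.rank (p b) < Ξ.rank (p a))
    (hS : ∀ x ∈ S, (∃ a, p a = x) ∨ x ∈ E) (hpS : ∀ a, p a ∈ S)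
    (hE : ∀ x ∈ E, x ≠ N.root ∧ (∀ a, p a ≠ x) ∧ N.cost s(x, N.root) = 0)
    (φ : ι → V → ℝ) (hφ : ∀ a x y, x ≠ y → φ a y - φ a x ≤ N.cost s(x, y))
    (hφ0 : ∀ a, φ a (p a) = 0) (hφr : ∀ a, N.cost (N.parentEdge p par a) ≤ φ a N.root)
    (hφp : ∀ a b, Ξ.rank (p b) < Ξ.rank (p a) → N.cost (N.parentEdge p par a) ≤ φ a (p b)) :
    N.IsNash (Ξ.toProtocol N) (S := S) fun i => T i := by
  have hmem : ∀ (P : N.Profile S) (i : S) (e), e ∈ (P i).1.edges → (i : V) ∈ N.users P e :=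
    fun P i e he => (N.mem_users).2 ⟨i.2, he⟩
  have hle : ∀ (P : N.Profile S) (i : S) (e), e ∈ (P i).1.edges →
      Ξ.toProtocol N e (N.users P e) i ≤ N.cost e := by
    intro P i e he
    rw [hΞ.toProtocol_apply N e (hmem P i e he)]
    split
    · exact le_rfl
    · exact N.cost_nonneg_of_mem_edges he
  have hnonneg : ∀ (P : N.Profile S) (i : S), 0 ≤ N.playerCost (Ξ.toProtocol N) P i := by
    intro P i
    refine Finset.sum_nonneg fun e he => ?_
    rw [List.mem_toFinset] at he
    rw [hΞ.toProtocol_apply N e (hmem P i e he)]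
    split
    · exact N.cost_nonneg_of_mem_edges he
    · exact le_rfl
  rintro ⟨x, hx⟩ q
  rcases hS x hx with ⟨a, rfl⟩ | hxE
  · set D := N.cost (N.parentEdge p par a) with hD
    have hD0 : 0 ≤ D := N.cost_nonneg_of_mem_edges (hT.parentEdge_mem a)
    trans D
    -- Every other edge of the route is the parent edge of an earlier player, who uses it.
    · trans ∑ e ∈ (T (p a)).1.edges.toFinset, if e = N.parentEdge p par a then D else 0
      · refine Finset.sum_le_sum fun e he => ?_
        rw [List.mem_toFinset] at he
        split
        · next h =>
          have := hle (fun i => T i) ⟨p a, hx⟩ e he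
          rwa [h] at this ⊢
        · next h =>
          obtain ⟨b, hb, rfl⟩ := hT.exists_of_mem_edges (κ := fun a => Ξ.rank (p a)) hκ a he
          rcases hb with rfl | hb
          · exact absurd rfl h
          · rw [hΞ.toProtocol_apply N _ (hmem (fun i => T i) ⟨p a, hx⟩ _ he), if_neg]
            intro hc
            exact absurd (hc (p b) (hmem (fun i => T i) ⟨p b, hpS b⟩ _ (hT.parentEdge_mem b)))
              (not_le.2 hb)
      · rw [Finset.sum_ite_eq']
        split
        · exact le_rfl
        · exact hD0
    · set Q : N.Profile S := Function.update (fun i => T i) ⟨p a, hx⟩ q with hQ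
      have hQa : Q ⟨p a, hx⟩ = q := Function.update_self ..
      have hfr : min D (φ a N.root) = D := min_eq_left (hφr a)
      -- Truncated at `D`, the potential still rises from `0` to `D`, but is constant along the
      -- edges that are free for the player.
      have h := q.sub_le_sum_edges (fun x => min D (φ a x))
        (fun e => Ξ.toProtocol N e (N.users Q e) (p a)) ?_
      · simp only [hfr, hφ0, min_eq_right hD0, sub_zero] at h
        rw [playerCost, hQa]
        exact h
      · intro x y hxy
        have hxyne : x ≠ y := (q.1.adj_of_mem_edges hxy).ne
        rw [hΞ.toProtocol_apply N _ (hmem Q ⟨p a, hx⟩ _ (hQa.symm ▸ hxy))]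
        split
        · have h1 := hφ a x y hxyne
          have h2 : 0 ≤ N.cost s(x, y) := N.cost_nonneg_of_mem_edges hxy
          rcases min_cases D (φ a x) with h3 | h3 <;> rcases min_cases D (φ a y) with h4 | h4 <;>
            linarith
        · next hc =>
          have hfree : ∀ z, D ≤ φ a z → min D (φ a z) = D := fun z => min_eq_left
          suffices h : D ≤ φ a x ∧ D ≤ φ a y by
            simp only [hfree x h.1, hfree y h.2, sub_self, le_refl]
          have hends : ∀ u v, s(x, y) = s(u, v) → D ≤ φ a u → D ≤ φ a v →
              D ≤ φ a x ∧ D ≤ φ a y := by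
            intro u v huv hu hv
            rcases Sym2.eq_iff.1 huv with ⟨rfl, rfl⟩ | ⟨rfl, rfl⟩
            · exact ⟨hu, hv⟩
            · exact ⟨hv, hu⟩
          push Not at hc
          obtain ⟨j, hj, hjlt⟩ := hc
          obtain ⟨hjS, hj⟩ := (N.mem_users).1 hj
          have hja : (⟨j, hjS⟩ : S) ≠ ⟨p a, hx⟩ := fun e =>
            absurd (congrArg (fun i : S => Ξ.rank i) e) hjlt.ne
          rw [hQ, Function.update_of_ne hja] at hj
          -- The free edge is either the parent edge of some `c` earlier than `a`, with both ends
          -- earlier or at the root, or a zero-cost edge from `E` to the root.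
          rcases hS j hjS with ⟨b, rfl⟩ | hjE
          · obtain ⟨c, hc, hce⟩ := hT.exists_of_mem_edges (κ := fun a => Ξ.rank (p a)) hκ b hj
            have hca : Ξ.rank (p c) < Ξ.rank (p a) := by
              rcases hc with rfl | hc
              · exact hjlt
              · exact hc.trans hjlt
            refine hends _ _ hce (hφp a c hca) ?_
            cases hd : par c with
            | none => exact hφr a
            | some d => exact hφp a d ((hκ c d hd).trans hca)
          · obtain ⟨h1, h2, h3⟩ := hE j hjE
            simp only [hT.edges_of_notMem j h2 h1, List.mem_singleton] at hj
            refine hends _ _ hj ?_ (hφr a)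
            have := hφ a j N.root h1
            have := hφr a
            linarith
  · refine le_trans ?_ (hnonneg _ _)
    obtain ⟨h1, h2, h3⟩ := hE x hxE
    refine Finset.sum_nonpos fun e he => ?_
    rw [List.mem_toFinset] at he
    have := hle (fun i => T i) ⟨x, hx⟩ e he
    simp only [hT.edges_of_notMem x h2 h1, List.mem_singleton] at he
    rw [he] at this ⊢
    linarith

end IsRouting

end Network

/-! ### The Price of Anarchy of a zig-zag path -/

open Finset in
theorem sum_range_gcd_two_pow (r : ℕ) :
    2 * ∑ a ∈ range (2 ^ r), Nat.gcd a (2 ^ r) = 2 ^ r * (r + 2) := by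
  have heo : ∀ (f : ℕ → ℕ) (n : ℕ),
      ∑ a ∈ range (2 * n), f a = ∑ b ∈ range n, f (2 * b) + ∑ b ∈ range n, f (2 * b + 1) := by
    intro f n
    induction n with
    | zero => simp
    | succ n ih =>
      rw [show 2 * (n + 1) = 2 * n + 1 + 1 by ring, sum_range_succ, sum_range_succ, ih,
        sum_range_succ, sum_range_succ]
      ring
  -- Even terms give twice the previous sum, and each of the `2 ^ r` odd terms is `1`.
  induction r with
  | zero => simp
  | succ r ih =>
    have h1 : ∑ b ∈ range (2 ^ r), Nat.gcd (2 * b) (2 ^ (r + 1)) =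
        2 * ∑ b ∈ range (2 ^ r), Nat.gcd b (2 ^ r) := by
      rw [mul_sum]
      exact sum_congr rfl fun b _ => gcd_two_mul_two_pow b r
    have h2 : ∑ b ∈ range (2 ^ r), Nat.gcd (2 * b + 1) (2 ^ (r + 1)) = 2 ^ r := by
      rw [sum_congr rfl fun b _ => gcd_two_pow_of_odd (show (2 * b + 1) % 2 = 1 by omega) (r + 1)]
      simp
    rw [show range (2 ^ (r + 1)) = range (2 * 2 ^ r) by rw [pow_succ'], heo, h1, h2, pow_succ']
    linear_combination 2 * ih

namespace Network

variable {V : Type*} [DecidableEq V]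

/-- The lower bound on the Price of Anarchy for an isometric zig-zag path; the vertices of `E` are
additional players at the root. -/
theorem le_priceOfAnarchy_of_zigzag (N : Network V) (hG : ∀ x y, x ≠ y → N.graph.Adj x y)
    {Ξ : GWSP V} (hΞ : Ξ.IsOrdered) {r : ℕ} {p : Fin (2 ^ r + 1) → V}
    (hp : Function.Injective p) (hroot : ∀ a, p a ≠ N.root) {S E : Finset V}
    (hS : ∀ x, x ∈ S ↔ (∃ a, p a = x) ∨ x ∈ E)
    (hE : ∀ x ∈ E, x ≠ N.root ∧ (∀ a, p a ≠ x) ∧ N.cost s(x, N.root) = 0)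
    (hcost : ∀ a b : Fin (2 ^ r + 1), N.cost s(p a, p b) = Nat.dist a b)
    (hcostr : ∀ a, N.cost s(p a, N.root) = 2 ^ r)
    (φ : Fin (2 ^ r + 1) → V → ℝ) (hφ : ∀ a x y, φ a y - φ a x ≤ N.cost s(x, y))
    (hφr : ∀ a, φ a N.root = 2 ^ r)
    (hφp : ∀ a b : Fin (2 ^ r + 1), φ a (p b) = Nat.dist a b)
    (hz : ∀ a b : Fin (2 ^ r + 1), Nat.gcd a (2 ^ r) < 2 ^ r →
      Nat.dist a b = Nat.gcd a (2 ^ r) → Ξ.rank (p b) < Ξ.rank (p a)) :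
    0 < N.opt S ∧
      ENNReal.ofReal ((r + 4) / 4) ≤ N.priceOfAnarchy (Ξ.toProtocol N) S := by
  have hpS : ∀ a, p a ∈ S := fun a => (hS _).2 (Or.inl ⟨a, rfl⟩)
  have hS' := fun x (hx : x ∈ S) => (hS x).1 hx
  have h2r : (0 : ℝ) < 2 ^ r := by positivity
  have hgle : ∀ a : ℕ, Nat.gcd a (2 ^ r) ≤ 2 ^ r :=
    fun a => Nat.le_of_dvd (by positivity) (Nat.gcd_dvd_right _ _)
  -- the optimum
  let par₁ : Fin (2 ^ r + 1) → Option (Fin (2 ^ r + 1)) := fun a =>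
    if (a : ℕ) = 0 then none else some ⟨a - 1, by omega⟩
  have hκ₁ : ∀ a b, par₁ a = some b → (b : ℕ) < a := by
    intro a b h
    simp only [par₁] at h
    split at h
    · simp at h
    · rw [← Option.some.inj h]
      simp only
      omega
  obtain ⟨T₁, hT₁⟩ := N.exists_isRouting (κ := fun a : Fin (2 ^ r + 1) => (a : ℕ)) hG hp hroot hκ₁
  have hopt_le : N.opt S ≤ 2 * 2 ^ r := by
    refine (N.opt_le_socialCost fun i => T₁ i).trans ((hT₁.socialCost_le_sum hp hroot hκ₁ hS'
      hE).trans_eq ?_)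
    -- One root edge of cost `2 ^ r`, and `2 ^ r` unit steps.
    have h1 : ∀ a, N.cost (N.parentEdge p par₁ a) = if (a : ℕ) = 0 then 2 ^ r else 1 := by
      intro a
      by_cases ha : (a : ℕ) = 0
      · rw [parentEdge, show par₁ a = none from if_pos ha, if_pos ha]
        exact hcostr a
      · have : Nat.dist (a : ℕ) (a - 1) = 1 := by simp only [Nat.dist]; omega
        rw [parentEdge, show par₁ a = some _ from if_neg ha, if_neg ha]
        simp [hcost, this]
    rw [Finset.sum_congr rfl fun a _ => h1 a, Fin.sum_univ_succ]
    simp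
    ring
  have hopt_pos : 0 < N.opt S := by
    refine h2r.trans_le ?_
    have : Nonempty (N.Profile S) := ⟨fun i => T₁ i⟩
    refine le_ciInf fun P => le_trans ?_ (N.sum_path_le_socialCost P ⟨p 0, hpS 0⟩)
    have := (P ⟨p 0, hpS 0⟩).sub_le_sum_edges (φ 0) N.cost fun x y _ => hφ 0 x y
    simp only [hφr, hφp] at this
    simpa [Nat.dist] using this
  -- the equilibrium
  let par₂ : Fin (2 ^ r + 1) → Option (Fin (2 ^ r + 1)) := fun a =>
    if Nat.gcd a (2 ^ r) < 2 ^ r then some ⟨a - Nat.gcd a (2 ^ r), by omega⟩ else none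
  have hdist : ∀ a : Fin (2 ^ r + 1), Nat.gcd a (2 ^ r) < 2 ^ r →
      Nat.dist a (a - Nat.gcd a (2 ^ r)) = Nat.gcd a (2 ^ r) := by
    intro a h
    have ha : 0 < (a : ℕ) := Nat.pos_of_ne_zero fun h0 => by simp [h0] at h
    have := Nat.le_of_dvd ha (Nat.gcd_dvd_left a (2 ^ r))
    simp only [Nat.dist]
    omega
  have hκ₂ : ∀ a b, par₂ a = some b → Ξ.rank (p b) < Ξ.rank (p a) := by
    intro a b h
    simp only [par₂] at h
    split at h
    · next hlt =>
      rw [← Option.some.inj h]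
      exact hz _ _ hlt (hdist a hlt)
    · simp at h
  obtain ⟨T₂, hT₂⟩ := N.exists_isRouting (κ := fun a => Ξ.rank (p a)) hG hp hroot hκ₂
  -- The two ends of the path have gcd `2 ^ r`, which is also the cost of their edges to the root.
  have hpe : ∀ a : Fin (2 ^ r + 1), N.cost (N.parentEdge p par₂ a) = Nat.gcd a (2 ^ r) := by
    intro a
    by_cases ha : Nat.gcd a (2 ^ r) < 2 ^ r
    · simp [parentEdge, par₂, ha, hcost, hdist a ha]
    · simp [parentEdge, par₂, hcostr, le_antisymm (hgle a) (not_lt.1 ha)]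
  have hnash : N.IsNash (Ξ.toProtocol N) (S := S) fun i => T₂ i := by
    refine hT₂.isNash hΞ hκ₂ hS' hpS hE φ (fun a x y _ => hφ a x y) ?_ ?_ ?_
    · intro a
      simp [hφp, Nat.dist]
    · intro a
      rw [hpe, hφr]
      exact_mod_cast hgle a
    · intro a b hab
      rw [hpe, hφp, Nat.cast_le]
      by_contra hlt
      exact (label_lt_of_dist_lt (l := fun a => Ξ.rank (p a)) hz a b
        (fun e => by simp [e] at hab) (not_le.1 hlt)).not_gt hab
  have hsc : (2 : ℝ) ^ r * (r + 4) / 2 ≤ N.socialCost (S := S) fun i => T₂ i := by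
    refine le_trans (le_of_eq ?_) (hT₂.sum_le_socialCost hp hroot hκ₂ hpS)
    rw [Finset.sum_congr rfl fun a _ => hpe a,
      Fin.sum_univ_eq_sum_range (fun a => ((Nat.gcd a (2 ^ r) : ℕ) : ℝ)) (2 ^ r + 1),
      Finset.sum_range_succ, Nat.gcd_self]
    have := congrArg (Nat.cast : ℕ → ℝ) (sum_range_gcd_two_pow r)
    push_cast at this ⊢
    linear_combination -this / 2
  refine ⟨hopt_pos, (ENNReal.ofReal_le_ofReal ?_).trans
    (N.ofReal_div_le_priceOfAnarchy hnash hopt_pos)⟩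
  rw [le_div_iff₀ hopt_pos]
  calc ((r : ℝ) + 4) / 4 * N.opt S ≤ (r + 4) / 4 * (2 * 2 ^ r) := by gcongr
    _ = 2 ^ r * (r + 4) / 2 := by ring
    _ ≤ _ := hsc

end Network

/-! ### The two networks -/

/-- The distance from a point of the hypercube, truncated at `ρ`, is a potential for the distance
costs. -/
theorem min_hammingDist_sub_le {n : ℕ} (ρ : ℝ) (v x y : Fin n → Bool) :
    min ρ (hammingDist v y : ℝ) - min ρ (hammingDist v x) ≤ hammingDist x y := by
  have h : (hammingDist v y : ℝ) ≤ hammingDist v x + hammingDist x y := by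
    exact_mod_cast hammingDist_triangle v x y
  have h' : (0 : ℝ) ≤ hammingDist x y := Nat.cast_nonneg _
  rcases min_cases ρ (hammingDist v x : ℝ) with h1 | h1 <;>
    rcases min_cases ρ (hammingDist v y : ℝ) with h2 | h2 <;> linarith

theorem IsIsometricPath.injective {n r : ℕ} {p : Fin (2 ^ r + 1) → Fin n → Bool}
    (hp : IsIsometricPath p) : Function.Injective p := by
  intro a b h
  have h1 := hp a b
  rw [h, hammingDist_self] at h1
  exact Fin.ext (Nat.eq_of_dist_eq_zero h1.symm)

theorem IsIsometricPath.min_hammingDist {n r : ℕ} {p : Fin (2 ^ r + 1) → Fin n → Bool}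
    (hp : IsIsometricPath p) (a b : Fin (2 ^ r + 1)) :
    min (2 ^ r : ℝ) (hammingDist (p a) (p b)) = Nat.dist a b := by
  rw [hp, min_eq_right]
  have : Nat.dist a b ≤ 2 ^ r := by simp only [Nat.dist]; omega
  exact_mod_cast this

theorem quarter_log_le {k r : ℕ} (hk0 : 0 < k) (hk : k ≤ 2 ^ (r + 1)) :
    1 / 4 * Real.log k ≤ ((r : ℝ) + 4) / 4 := by
  have h1 : Real.log k ≤ Real.log ((2 : ℝ) ^ (r + 1)) :=
    Real.log_le_log (by exact_mod_cast hk0) (by exact_mod_cast hk)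
  rw [Real.log_pow] at h1
  push_cast at h1
  have h2 : ((r : ℝ) + 1) * Real.log 2 ≤ (r + 1) * 1 := by
    gcongr
    linarith [Real.log_two_lt_d9]
  linarith

/-- The hypercube with a root `inr 0` and `m` further vertices at distance zero from the root. All
of these are at distance `ρ` from the hypercube. -/
noncomputable def hubHypercube (n m : ℕ) (ρ : ℝ≥0) : Network ((Fin n → Bool) ⊕ Fin (m + 1)) where
  graph := ⊤
  connected := SimpleGraph.connected_top
  root := Sum.inr 0
  cost := Sym2.lift ⟨fun
    | .inl x, .inl y => (hammingDist x y : ℝ)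
    | .inr _, .inr _ => 0
    | _, _ => (ρ : ℝ), by
      rintro (x | x) (y | y) <;> simp [hammingDist_comm]⟩
  cost_nonneg := by
    intro e _
    induction e with
    | _ x y => rcases x with x | x <;> rcases y with y | y <;> simp

/-- The `m` hub players besides the root adjust the number of players without changing any cost. -/
theorem exists_le_priceOfAnarchy_hubHypercube (r m : ℕ) :
    ∃ n, ∀ Ξ : GWSP ((Fin n → Bool) ⊕ Fin (m + 1)), Ξ.IsOrdered →
      ∃ S : Finset ((Fin n → Bool) ⊕ Fin (m + 1)),
        (hubHypercube n m (2 ^ r)).root ∉ S ∧ S.card = 2 ^ r + 1 + m ∧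
        0 < (hubHypercube n m (2 ^ r)).opt S ∧
        ENNReal.ofReal ((r + 4) / 4) ≤ (hubHypercube n m (2 ^ r)).priceOfAnarchy
          (Ξ.toProtocol (hubHypercube n m (2 ^ r))) S := by
  obtain ⟨n, hn⟩ := exists_zigzag_path r
  refine ⟨n, fun Ξ hΞ => ?_⟩
  obtain ⟨p, hp, hz⟩ := hn (fun x => Ξ.rank (Sum.inl x)) (hΞ.comp Sum.inl_injective)
  let E : Finset ((Fin n → Bool) ⊕ Fin (m + 1)) := Finset.univ.image fun i : Fin m => .inr i.succ
  have hinj : Function.Injective fun a => (Sum.inl (p a) : (Fin n → Bool) ⊕ Fin (m + 1)) :=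
    Sum.inl_injective.comp hp.injective
  have hdisj : Disjoint (Finset.univ.image fun a => (Sum.inl (p a) : (Fin n → Bool) ⊕ Fin (m + 1)))
      E := by
    rw [Finset.disjoint_left]
    simp [E]
  have hEcard : E.card = m :=
    (Finset.card_image_of_injective _ (Sum.inr_injective.comp (Fin.succ_injective m))).trans
      (Finset.card_fin m)
  have hρ : ((2 ^ r : ℝ≥0) : ℝ) = 2 ^ r := by push_cast; rfl
  refine ⟨Finset.univ.image (fun a => Sum.inl (p a)) ∪ E, ?_, ?_, ?_⟩
  · simp [hubHypercube, E, Fin.succ_ne_zero]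
  · rw [Finset.card_union_of_disjoint hdisj, Finset.card_image_of_injective _ hinj, hEcard]
    simp
  · refine (hubHypercube n m (2 ^ r)).le_priceOfAnarchy_of_zigzag (E := E)
      (p := fun a => Sum.inl (p a)) (fun x y h => h) hΞ hinj (fun a => Sum.inl_ne_inr) ?_ ?_ ?_ ?_
      -- Without truncation the potential could rise by more than `2 ^ r` on an edge from a hub back
      -- to a distant cube point.
      (fun a => Sum.elim (fun y => min (2 ^ r : ℝ) (hammingDist (p a) y)) fun _ => 2 ^ r)
      ?_ ?_ ?_ hz
    · intro x
      simp
    · intro x hx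
      obtain ⟨i, -, rfl⟩ := Finset.mem_image.1 hx
      exact ⟨fun h => Fin.succ_ne_zero i (Sum.inr_injective h), fun a => Sum.inl_ne_inr, rfl⟩
    · intro a b
      exact congrArg Nat.cast (hp a b)
    · intro a
      exact hρ
    · rintro a (x | x) (y | y)
      · exact min_hammingDist_sub_le _ _ _ _
      · change _ ≤ ((2 ^ r : ℝ≥0) : ℝ)
        rw [hρ]
        have : (0 : ℝ) ≤ min (2 ^ r : ℝ) (hammingDist (p a) x) := by positivity
        simp only [Sum.elim_inl, Sum.elim_inr]
        linarith
      · change _ ≤ ((2 ^ r : ℝ≥0) : ℝ)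
        rw [hρ]
        have := min_le_left (2 ^ r : ℝ) (hammingDist (p a) y)
        have h2 : (0 : ℝ) < 2 ^ r := by positivity
        simp only [Sum.elim_inl, Sum.elim_inr]
        linarith
      · exact (sub_self _).le
    · intro a
      rfl
    · exact hp.min_hammingDist

theorem exists_le_priceOfAnarchy_rootedHypercube (r : ℕ) :
    ∃ n, ∀ Ξ : GWSP (Option (Fin n → Bool)), Ξ.IsOrdered →
      ∃ (p : Fin (2 ^ r + 1) → Fin n → Bool) (S : Finset (Option (Fin n → Bool))),
        IsIsometricPath p ∧ IsZigZag (fun a => Ξ.rank (some (p a))) ∧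
        S = Finset.univ.image (fun a => some (p a)) ∧ S.card = 2 ^ r + 1 ∧
        0 < (rootedHypercube n (2 ^ r)).opt S ∧
        ENNReal.ofReal ((r + 4) / 4) ≤ (rootedHypercube n (2 ^ r)).priceOfAnarchy
          (Ξ.toProtocol (rootedHypercube n (2 ^ r))) S := by
  obtain ⟨n, hn⟩ := exists_zigzag_path r
  refine ⟨n, fun Ξ hΞ => ?_⟩
  obtain ⟨p, hp, hz⟩ := hn (fun x => Ξ.rank (some x)) (hΞ.comp (Option.some_injective _))
  have hinj : Function.Injective fun a => some (p a) :=
    (Option.some_injective _).comp hp.injective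
  have hρ : ((2 ^ r : ℝ≥0) : ℝ) = 2 ^ r := by push_cast; rfl
  refine ⟨p, _, hp, isZigZag_of_gcd hz, rfl, ?_, ?_⟩
  · rw [Finset.card_image_of_injective _ hinj]
    simp
  · refine (rootedHypercube n (2 ^ r)).le_priceOfAnarchy_of_zigzag (E := ∅)
      (p := fun a => some (p a)) (fun x y h => h) hΞ hinj (fun a => Option.some_ne_none _) ?_
      (by simp) ?_ ?_
      (fun a x => x.elim (2 ^ r) fun y => min (2 ^ r : ℝ) (hammingDist (p a) y)) ?_ ?_ ?_ hz
    · intro x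
      simp
    · intro a b
      exact congrArg Nat.cast (hp a b)
    · intro a
      exact hρ
    · rintro a (_ | x) (_ | y)
      · change _ ≤ ((2 ^ r : ℝ≥0) : ℝ)
        simp
      · change _ ≤ ((2 ^ r : ℝ≥0) : ℝ)
        rw [hρ]
        have := min_le_left (2 ^ r : ℝ) (hammingDist (p a) y)
        have h2 : (0 : ℝ) < 2 ^ r := by positivity
        simp only [Option.elim_some, Option.elim_none]
        linarith
      · change _ ≤ ((2 ^ r : ℝ≥0) : ℝ)
        rw [hρ]
        have : (0 : ℝ) ≤ min (2 ^ r : ℝ) (hammingDist (p a) x) := by positivity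
        simp only [Option.elim_some, Option.elim_none]
        linarith
      · exact min_hammingDist_sub_le _ _ _ _
    · intro a
      rfl
    · exact hp.min_hammingDist

theorem mainTheorem2 :
    ∃ c : ℝ, 0 < c ∧
      (∀ k : ℕ, 2 ≤ k →
        ∃ (V : Type) (_ : Fintype V) (_ : DecidableEq V) (N : Network V),
          ∀ Ξ : GWSP V, Ξ.IsOrdered →
            ∃ S : Finset V, N.root ∉ S ∧ S.card = k ∧ 0 < N.opt S ∧
              ENNReal.ofReal (c * Real.log k) ≤ N.priceOfAnarchy (Ξ.toProtocol N) S) ∧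
      (∀ r : ℕ, 1 ≤ r → ∃ n : ℕ,
        ∀ Ξ : GWSP (Option (Fin n → Bool)), Ξ.IsOrdered →
          ∃ (p : Fin (2 ^ r + 1) → Fin n → Bool) (S : Finset (Option (Fin n → Bool))),
            IsIsometricPath p ∧ IsZigZag (fun a => Ξ.rank (some (p a))) ∧
            S = Finset.univ.image (fun a => some (p a)) ∧ S.card = 2 ^ r + 1 ∧
            0 < (rootedHypercube n (2 ^ r)).opt S ∧
            ENNReal.ofReal (c * Real.log (2 ^ r + 1)) ≤
              (rootedHypercube n (2 ^ r)).priceOfAnarchy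
                (Ξ.toProtocol (rootedHypercube n (2 ^ r))) S) := by

  refine ⟨1 / 4, by norm_num, fun k hk => ?_, fun r _ => ?_⟩
  -- The largest `r` with `2 ^ r + 1 ≤ k`; the remaining players sit at the hub.
  · set r := Nat.log 2 (k - 1)
    have h1 : 2 ^ r ≤ k - 1 := Nat.pow_log_le_self 2 (by omega)
    have h2 : k - 1 < 2 ^ (r + 1) := Nat.lt_pow_succ_log_self (by norm_num) _
    obtain ⟨n, hn⟩ := exists_le_priceOfAnarchy_hubHypercube r (k - (2 ^ r + 1))
    refine ⟨_, inferInstance, inferInstance, hubHypercube n (k - (2 ^ r + 1)) (2 ^ r),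
      fun Ξ hΞ => ?_⟩
    obtain ⟨S, hS, hcard, hopt, hpoa⟩ := hn Ξ hΞ
    exact ⟨S, hS, by omega, hopt, (ENNReal.ofReal_le_ofReal
      (quarter_log_le (by omega) (by omega))).trans hpoa⟩
  · obtain ⟨n, hn⟩ := exists_le_priceOfAnarchy_rootedHypercube r
    refine ⟨n, fun Ξ hΞ => ?_⟩
    obtain ⟨p, S, hp, hz, hS, hcard, hopt, hpoa⟩ := hn Ξ hΞ
    refine ⟨p, S, hp, hz, hS, hcard, hopt, (ENNReal.ofReal_le_ofReal ?_).trans hpoa⟩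
    have := quarter_log_le (k := 2 ^ r + 1) (r := r) (Nat.succ_pos _)
      (by rw [pow_succ]; have := Nat.one_le_two_pow (n := r); omega)
    exact_mod_cast this
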